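/- Let $L^2(\mathbb{R})$ be the complex Hilbert space of square-integrable functions on $\mathbb{R}$ and let $H^1(\mathbb{R})$ be the space of those $f\in L^2(\mathbb{R})$ whose weak derivative $f'$ exists and lies in $L^2(\mathbb{R})$; every such $f$ has a unique continuous representative, and $f(x)$ denotes its value at $x$. For each integer $n\ge 1$, let $C_n$ be the operator $f\mapsto i f'$ on $L^2(\mathbb{R})$ with domain $$\mathcal{D}(C_n)=\Big\{f\in H^1(\mathbb{R}) : \sum_{j=0}^{n-1} f\big(\tfrac{j}{n}\big)=0\Big\},$$ and let $C_\infty$ be the operator $f\mapsto i f'$ on $L^2(\mathbb{R})$ with domain $$\mathcal{D}(C_\infty)=\Big\{f\in H^1(\mathbb{R}) : \int_0^1 f(x)\,dx=0\Big\}.$$ Then every $C_n$ is densely defined, $C_\infty$ is not densely defined, all the operators $C_n$ and $C_\infty$ are closed, and $C_n$ converges to $C_\infty$ in the generalized sense of Kato as $n\to\infty$; that is, $$\lim_{n\to\infty}\big\|P(\Gamma(C_n))-P(\Gamma(C_\infty))\big\|=0,$$ where $\Gamma(C)=\{(f,Cf) : f\in\mathcal{D}(C)\}$ is the graph of $C$,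 a closed subspace of the Hilbert space $L^2(\mathbb{R})\oplus L^2(\mathbb{R})$, $P(\Gamma(C))$ is the orthogonal projection onto it, and the norm is the operator norm. -/

import Mathlib

open MeasureTheory Filter Topology
open scoped ContDiff

noncomputable section

/-! ### Generalized convergence of closed operators -/

section Kato

variable {H : Type*} [NormedAddCommGroup H] [InnerProductSpace ℂ H]

/-- The graph `Γ(A) = {(ψ, A ψ) : ψ ∈ D(A)}`, as a subspace of the Hilbert space sum `H ⊕ H`
(i.e. the product with the norm `‖(ψ, χ)‖² = ‖ψ‖² + ‖χ‖²`). -/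
def hilbertGraph (A : H →ₗ.[ℂ] H) : Submodule ℂ (WithLp 2 (H × H)) :=
  A.graph.comap (WithLp.linearEquiv 2 ℂ (H × H)).toLinearMap

theorem isClosed_hilbertGraph {A : H →ₗ.[ℂ] H} (hA : A.IsClosed) :
    IsClosed (hilbertGraph A : Set (WithLp 2 (H × H))) :=
  IsClosed.preimage (WithLp.prod_continuous_ofLp 2 H H) hA

/-- The orthogonal projection `P(Γ(A))` of `H ⊕ H` onto the graph of a closed operator `A`. -/
def graphProjection [CompleteSpace H] (A : H →ₗ.[ℂ] H) (hA : A.IsClosed) :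
    WithLp 2 (H × H) →L[ℂ] WithLp 2 (H × H) :=
  haveI : CompleteSpace (hilbertGraph A) := (isClosed_hilbertGraph hA).completeSpace_coe
  (hilbertGraph A).starProjection

/-- Generalized convergence (in the sense of Kato) of a sequence of closed operators on a Hilbert
space to a closed operator: the orthogonal projections onto the graphs converge in operator norm.
All operators involved are required to be closed. -/
def ConvergesGeneralized [CompleteSpace H] (A : ℕ → H →ₗ.[ℂ] H) (B : H →ₗ.[ℂ] H) : Prop :=
  ∃ (hA : ∀ n, (A n).IsClosed) (hB : B.IsClosed),
    Tendsto (fun n => ‖graphProjection (A n) (hA n) - graphProjection B hB‖) atTop (𝓝 0)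

end Kato

/-! ### The momentum operator on the real line -/

/-- The complex Hilbert space `L²(ℝ)`. -/
abbrev L2R : Type := Lp ℂ 2 (volume : Measure ℝ)

/-- `g` is the weak derivative of `f`: `∫ f φ' = - ∫ g φ` for all test functions `φ ∈ C_c^∞(ℝ)`. -/
def IsWeakDeriv (f g : L2R) : Prop :=
  ∀ φ : ℝ → ℝ, ContDiff ℝ ∞ φ → HasCompactSupport φ →
    ∫ x, deriv φ x • f x = -∫ x, φ x • g x

theorem L2R.locallyIntegrable (f : L2R) : LocallyIntegrable (f : ℝ → ℂ) :=
  (Lp.memLp f).locallyIntegrable (by norm_num)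

theorem L2R.integrable_smul (f : L2R) {φ : ℝ → ℝ} (hφ : Continuous φ) (h : HasCompactSupport φ) :
    Integrable (fun x => φ x • f x) :=
  f.locallyIntegrable.integrable_smul_left_of_hasCompactSupport hφ h

theorem IsWeakDeriv.unique {f g₁ g₂ : L2R} (h₁ : IsWeakDeriv f g₁) (h₂ : IsWeakDeriv f g₂) :
    g₁ = g₂ := by
  apply Lp.ext
  apply ae_eq_of_integral_contDiff_smul_eq g₁.locallyIntegrable g₂.locallyIntegrable
  intro φ hφ hc
  exact neg_injective ((h₁ φ hφ hc).symm.trans (h₂ φ hφ hc))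

theorem IsWeakDeriv.add {f₁ f₂ g₁ g₂ : L2R} (h₁ : IsWeakDeriv f₁ g₁) (h₂ : IsWeakDeriv f₂ g₂) :
    IsWeakDeriv (f₁ + f₂) (g₁ + g₂) := by
  intro φ hφ hc
  have key : ∀ (ψ : ℝ → ℝ) (a b : L2R), Continuous ψ → HasCompactSupport ψ →
      ∫ x, ψ x • (a + b : L2R) x = (∫ x, ψ x • a x) + ∫ x, ψ x • b x := by
    intro ψ a b hψ hψc
    rw [← integral_add (a.integrable_smul hψ hψc) (b.integrable_smul hψ hψc)]
    apply integral_congr_ae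
    filter_upwards [Lp.coeFn_add a b] with x hx
    rw [hx, Pi.add_apply, smul_add]
  rw [key _ _ _ (hφ.continuous_deriv (by simp)) hc.deriv, key _ _ _ hφ.continuous hc,
    h₁ φ hφ hc, h₂ φ hφ hc, neg_add]

theorem IsWeakDeriv.smul {f g : L2R} (c : ℂ) (h : IsWeakDeriv f g) :
    IsWeakDeriv (c • f) (c • g) := by
  intro φ hφ hc
  have key : ∀ (ψ : ℝ → ℝ) (a : L2R),
      ∫ x, ψ x • (c • a : L2R) x = c • ∫ x, ψ x • a x := by
    intro ψ a
    rw [← integral_smul]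
    apply integral_congr_ae
    filter_upwards [Lp.coeFn_smul c a] with x hx
    rw [hx, Pi.smul_apply, smul_comm]
  rw [key, key, h φ hφ hc, smul_neg]

theorem IsWeakDeriv.zero : IsWeakDeriv 0 0 := by
  simpa using IsWeakDeriv.smul (f := 0) (g := 0) 0 (fun φ _ _ => by
    have key : ∀ ψ : ℝ → ℝ, ∫ x, ψ x • (0 : L2R) x = 0 := by
      intro ψ
      apply integral_eq_zero_of_ae
      filter_upwards [Lp.coeFn_zero ℂ 2 (volume : Measure ℝ)] with x hx
      simp
    rw [key, key, neg_zero])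

/-- The Sobolev space `H¹(ℝ)`, as a subspace of `L²(ℝ)`. -/
def sobolevH1 : Submodule ℂ L2R where
  carrier := {f | ∃ g : L2R, IsWeakDeriv f g}
  add_mem' := fun ⟨g₁, h₁⟩ ⟨g₂, h₂⟩ => ⟨g₁ + g₂, h₁.add h₂⟩
  zero_mem' := ⟨0, IsWeakDeriv.zero⟩
  smul_mem' := fun c _ ⟨g, h⟩ => ⟨c • g, h.smul c⟩

/-- The weak derivative `f'` of `f ∈ H¹(ℝ)`, an element of `L²(ℝ)`. -/
def weakDeriv (f : sobolevH1) : L2R := Classical.choose f.2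

theorem isWeakDeriv_weakDeriv (f : sobolevH1) : IsWeakDeriv f (weakDeriv f) :=
  Classical.choose_spec f.2

/-- The momentum operator `f ↦ i f'` on `L²(ℝ)` with domain `H¹(ℝ)`. -/
def momentumOperator : L2R →ₗ.[ℂ] L2R where
  domain := sobolevH1
  toFun :=
    { toFun := fun f => Complex.I • weakDeriv f
      map_add' := fun f g => by
        rw [← smul_add]
        exact congrArg _ ((isWeakDeriv_weakDeriv (f + g)).unique
          ((isWeakDeriv_weakDeriv f).add (isWeakDeriv_weakDeriv g)))
      map_smul' := fun c f => by
        rw [RingHom.id_apply, smul_comm c]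
        exact congrArg _ ((isWeakDeriv_weakDeriv (c • f)).unique
          ((isWeakDeriv_weakDeriv f).smul c)) }

/-! ### The two restrictions -/

/-- The subspace of those `f ∈ L²(ℝ)` which have a (necessarily unique) continuous representative
`u`, and this representative satisfies `∑_{j < n} u (j / n) = 0`. -/
def riemannSumZero (n : ℕ) : Submodule ℂ L2R where
  carrier := {f | ∃ u : ℝ → ℂ, Continuous u ∧ f =ᵐ[volume] u ∧
    ∑ j ∈ Finset.range n, u ((j : ℝ) / (n : ℝ)) = 0}
  add_mem' := by
    rintro f g ⟨u, hu, hfu, hu0⟩ ⟨v, hv, hgv, hv0⟩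
    refine ⟨u + v, hu.add hv, (Lp.coeFn_add f g).trans (hfu.add hgv), ?_⟩
    simp [Finset.sum_add_distrib, hu0, hv0]
  zero_mem' := ⟨0, continuous_zero, Lp.coeFn_zero _ _ _, by simp⟩
  smul_mem' := by
    rintro c f ⟨u, hu, hfu, hu0⟩
    refine ⟨c • u, hu.const_smul c, (Lp.coeFn_smul c f).trans (hfu.const_smul c), ?_⟩
    simp [← Finset.mul_sum, hu0]

theorem L2R.intervalIntegrable (f : L2R) (a b : ℝ) :
    IntervalIntegrable (f : ℝ → ℂ) volume a b :=
  (f.locallyIntegrable.integrableOn_isCompact isCompact_uIcc).intervalIntegrable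

/-- The subspace of those `f ∈ L²(ℝ)` with `∫_0^1 f(x) dx = 0`. -/
def integralZero : Submodule ℂ L2R where
  carrier := {f | ∫ x in (0 : ℝ)..1, f x = 0}
  add_mem' := by
    intro f g hf hg
    have h : ∫ x in (0 : ℝ)..1, (f + g : L2R) x =
        (∫ x in (0 : ℝ)..1, f x) + ∫ x in (0 : ℝ)..1, g x := by
      rw [← intervalIntegral.integral_add (f.intervalIntegrable 0 1) (g.intervalIntegrable 0 1)]
      apply intervalIntegral.integral_congr_ae
      filter_upwards [Lp.coeFn_add f g] with x hx _ using hx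
    rw [Set.mem_ofPred_eq] at *
    rw [h, hf, hg, add_zero]
  zero_mem' := by
    rw [Set.mem_ofPred_eq]
    apply intervalIntegral.integral_zero_ae
    filter_upwards [Lp.coeFn_zero ℂ 2 (volume : Measure ℝ)] with x hx _ using hx
  smul_mem' := by
    intro c f hf
    have h : ∫ x in (0 : ℝ)..1, (c • f : L2R) x = c • ∫ x in (0 : ℝ)..1, f x := by
      rw [← intervalIntegral.integral_smul]
      apply intervalIntegral.integral_congr_ae
      filter_upwards [Lp.coeFn_smul c f] with x hx _ using hx
    rw [Set.mem_ofPred_eq] at *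
    rw [h, hf, smul_zero]

/-- `C_n`: the restriction of `f ↦ i f'` to `{f ∈ H¹(ℝ) : ∑_{j < n} f(j/n) = 0}`. -/
def riemannSumMomentum (n : ℕ) : L2R →ₗ.[ℂ] L2R :=
  momentumOperator.domRestrict (riemannSumZero n)

/-- `C_∞`: the restriction of `f ↦ i f'` to `{f ∈ H¹(ℝ) : ∫_0^1 f(x) dx = 0}`. -/
def integralMomentum : L2R →ₗ.[ℂ] L2R :=
  momentumOperator.domRestrict integralZero

end

/-! ### Primitives of locally integrable functions -/

section Primitive

variable {u g : ℝ → ℂ}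

/-! The graph `M` of `f ↦ i f'` on `H¹(ℝ)` is closed, and each constraint cuts out a hyperplane `M ⊓
wᗮ` of it. For the integral, `w₀ = (1_{(0,1]}, 0)`. For the Riemann sum, integration by parts on
each cell `(j/n, (j+1)/n]` gives `∫₀¹ sₙ f' = ∫₀¹ f - n⁻¹ ∑ f(j/n)`, where `sₙ(t)` is the distance
from `t` to the next multiple of `1/n` (`integral_sawtooth_smul_of_primitive`). So `wₙ = (1_{(0,1]},
-i sₙ)`, and `wₙ → w₀` because `|sₙ| ≤ 1/n`.

The projection onto `M ⊓ wᗮ` is `P_M` minus the projection onto the line through `P_M w`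
(`starProjection_inf_orthogonal_span`). The latter depends norm-continuously on `w` as long as `P_M
w ≠ 0`, and `P_M w₀ ≠ 0` since some `f ∈ H¹(ℝ)` has nonzero integral over `[0,1]`.

The domains differ in density because the integral over `[0,1]` is a bounded functional on `L²`,
while point values can be changed at arbitrarily small `L²` cost. -/

theorem MeasureTheory.LocallyIntegrable.intervalIntegrable_real {E : Type*} [NormedAddCommGroup E]
    {g : ℝ → E} (hg : LocallyIntegrable g) (a b : ℝ) : IntervalIntegrable g volume a b :=
  (hg.integrableOn_isCompact isCompact_uIcc).intervalIntegrable

/-- Increments of `u` are dominated by those of the primitive of `‖g‖`. -/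
theorem absolutelyContinuousOnInterval_of_primitive (hg : LocallyIntegrable g)
    (hu : ∀ x y, u y - u x = ∫ t in x..y, g t) (a b : ℝ) :
    AbsolutelyContinuousOnInterval u a b := by
  have hi : ∀ x y, IntervalIntegrable (fun t => ‖g t‖) volume x y := fun x y =>
    (hg.intervalIntegrable_real x y).norm
  refine squeeze_zero (fun E => Finset.sum_nonneg fun i _ => dist_nonneg)
    (fun E => Finset.sum_le_sum fun i _ => ?_)
    ((hi a b).absolutelyContinuousOnInterval_intervalIntegral (c := a) (by simp))
  rw [dist_comm, dist_eq_norm, dist_comm, Real.dist_eq, hu,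
    intervalIntegral.integral_interval_sub_left (hi _ _) (hi _ _)]
  exact intervalIntegral.norm_integral_le_abs_integral_norm

theorem continuous_of_primitive (hg : LocallyIntegrable g)
    (hu : ∀ x y, u y - u x = ∫ t in x..y, g t) : Continuous u := by
  have h : u = fun x => u 0 + ∫ t in (0 : ℝ)..x, g t := by
    ext x
    rw [← hu, add_sub_cancel]
  rw [h]
  exact continuous_const.add
    (intervalIntegral.continuous_primitive (fun x y => hg.intervalIntegrable_real x y) 0)

theorem ae_hasDerivAt_of_primitive (hg : LocallyIntegrable g)
    (hu : ∀ x y, u y - u x = ∫ t in x..y, g t) : ∀ᵐ x, HasDerivAt u (g x) x := by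
  have h : u = fun x => u 0 + ∫ t in (0 : ℝ)..x, g t := by
    ext x
    rw [← hu, add_sub_cancel]
  filter_upwards [_root_.LocallyIntegrable.ae_hasDerivAt_integral hg] with x hx
  rw [h]
  exact (hx 0).const_add _

/-- Integration by parts for a `C¹` function and a primitive of a locally integrable function. -/
theorem integral_deriv_smul_add_of_primitive {φ : ℝ → ℝ} (hφ : ContDiff ℝ 1 φ)
    (hg : LocallyIntegrable g) (hu : ∀ x y, u y - u x = ∫ t in x..y, g t) (a b : ℝ) :
    ∫ x in a..b, (deriv φ x • u x + φ x • g x) = φ b • u b - φ a • u a := by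
  have huc := continuous_of_primitive hg hu
  set F : ℝ → ℂ := fun x => deriv φ x • u x + φ x • g x with hF
  have hFl : LocallyIntegrable F := by
    refine LocallyIntegrable.add ?_ ?_
    · exact ((hφ.continuous_deriv le_rfl).smul huc).locallyIntegrable
    · intro x
      have := (hg.locallyIntegrableOn Set.univ).continuousOn_smul
        isOpen_univ.isLocallyClosed hφ.continuous.continuousOn
      exact (locallyIntegrableOn_univ.1 this) x
  set I : ℝ → ℂ := fun x => ∫ t in a..x, F t with hI
  have hIp : ∀ x y, I y - I x = ∫ t in x..y, F t := fun x y =>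
    intervalIntegral.integral_interval_sub_left (hFl.intervalIntegrable_real _ _)
      (hFl.intervalIntegrable_real _ _)
  -- By the product rule this difference has zero derivative a.e.; being absolutely continuous, it
  -- is constant.
  have hac : AbsolutelyContinuousOnInterval (φ • u - I) a b :=
    ((hφ.contDiffOn.absolutelyContinuousOnInterval).smul
      (absolutelyContinuousOnInterval_of_primitive hg hu a b)).sub
      (absolutelyContinuousOnInterval_of_primitive hFl hIp a b)
  obtain ⟨C, hC⟩ := hac.const_of_ae_hasDerivAt_zero (by
    filter_upwards [ae_hasDerivAt_of_primitive hg hu, ae_hasDerivAt_of_primitive hFl hIp]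
      with x h1 h2 _
    have h3 := (((hφ.differentiable one_ne_zero) x).hasDerivAt.smul h1).sub h2
    convert h3 using 1
    simp only [hF]
    rw [add_comm, sub_self])
  have ha := hC a (by simp)
  have hb := hC b (by simp)
  have hIa : I a = 0 := by simp [hI]
  simp only [Pi.sub_apply, Pi.smul_apply', hIa, sub_zero] at ha hb
  change I b = _
  rw [ha, ← hb]
  ring

end Primitive

/-! ### The du Bois-Reymond lemma and continuous representatives -/

theorem HasCompactSupport.exists_forall_abs_le {E : Type*} [Zero E] {φ : ℝ → E}
    (h : HasCompactSupport φ) : ∃ R : ℝ, ∀ x, R ≤ |x| → φ x = 0 := by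
  obtain ⟨r, hr⟩ := h.isCompact.isBounded.subset_ball (0 : ℝ)
  refine ⟨r, fun x hx => image_eq_zero_of_notMem_tsupport fun hmem => ?_⟩
  have := hr hmem
  rw [Metric.mem_ball, Real.dist_eq, sub_zero] at this
  exact absurd hx (not_le.2 this)

theorem integral_eq_intervalIntegral_of_abs {E : Type*} [NormedAddCommGroup E] [NormedSpace ℝ E]
    {f : ℝ → E} {R : ℝ} (h : ∀ x, R ≤ |x| → f x = 0) :
    ∫ x, f x = ∫ x in (-R)..R, f x := by
  refine (intervalIntegral.integral_eq_integral_of_support_subset fun x hx => ?_).symm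
  have hx' : |x| < R := by
    by_contra! hc
    exact hx (h x hc)
  exact ⟨(abs_lt.1 hx').1, (abs_lt.1 hx').2.le⟩

/-- The primitive from the left of the support vanishes again on the right exactly because the total
integral is zero. -/
theorem exists_antideriv_hasCompactSupport {χ : ℝ → ℝ} (hχ : ContDiff ℝ ∞ χ)
    (hc : HasCompactSupport χ) (h0 : ∫ x, χ x = 0) :
    ∃ Φ : ℝ → ℝ, ContDiff ℝ ∞ Φ ∧ HasCompactSupport Φ ∧ deriv Φ = χ := by
  obtain ⟨R, hz⟩ := hc.exists_forall_abs_le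
  have hderiv : deriv (fun x => ∫ t in (-R)..x, χ t) = χ := by
    ext x
    exact hχ.continuous.deriv_integral χ (-R) x
  have hi : ∀ x y, IntervalIntegrable χ volume x y := fun x y =>
    hχ.continuous.intervalIntegrable x y
  refine ⟨fun x => ∫ t in (-R)..x, χ t, ?_, ?_, hderiv⟩
  · rw [contDiff_infty_iff_deriv, hderiv]
    exact ⟨fun x => (intervalIntegral.integral_hasDerivAt_right (hi _ _)
      hχ.continuous.stronglyMeasurable.stronglyMeasurableAtFilter
      hχ.continuous.continuousAt).differentiableAt, hχ⟩
  · refine HasCompactSupport.intro (isCompact_Icc (a := -R) (b := R)) fun x hx => ?_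
    have hx' : x < -R ∨ R < x := by
      by_contra! hcon
      exact hx hcon
    rcases hx' with hx' | hx'
    · refine intervalIntegral.integral_zero_ae (Eventually.of_forall fun t ht => hz t ?_)
      rw [Set.uIoc_of_ge hx'.le] at ht
      exact le_abs.2 (Or.inr (by linarith [ht.2]))
    · rw [← intervalIntegral.integral_add_adjacent_intervals (hi (-R) R) (hi R x),
        ← integral_eq_intervalIntegral_of_abs hz, h0, zero_add]
      refine intervalIntegral.integral_zero_ae (Eventually.of_forall fun t ht => hz t ?_)
      rw [Set.uIoc_of_le hx'.le] at ht
      exact le_abs.2 (Or.inl ht.1.le)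

/-- A locally integrable function on the line with vanishing weak derivative is constant. -/
theorem exists_ae_eq_const_of_integral_deriv_smul_eq_zero {h : ℝ → ℂ} (hh : LocallyIntegrable h)
    (h0 : ∀ φ : ℝ → ℝ, ContDiff ℝ ∞ φ → HasCompactSupport φ → ∫ x, deriv φ x • h x = 0) :
    ∃ c : ℂ, h =ᵐ[volume] fun _ => c := by
  let b : ContDiffBump (0 : ℝ) := ⟨1, 2, one_pos, one_lt_two⟩
  let ψ : ℝ → ℝ := b.normed volume
  have hψ : ContDiff ℝ ∞ ψ := b.contDiff_normed
  have hψc : HasCompactSupport ψ := b.hasCompactSupport_normed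
  have hψ1 : ∫ x, ψ x = 1 := b.integral_normed
  refine ⟨∫ x, ψ x • h x, ae_eq_of_integral_contDiff_smul_eq hh (locallyIntegrable_const _) ?_⟩
  intro φ hφ hφc
  have hint : ∀ {η : ℝ → ℝ}, ContDiff ℝ ∞ η → HasCompactSupport η →
      Integrable (fun x => η x • h x) := fun h1 h2 =>
    hh.integrable_smul_left_of_hasCompactSupport h1.continuous h2
  have hφi : Integrable φ := hφ.continuous.integrable_of_hasCompactSupport hφc
  have hψi : Integrable ψ := hψ.continuous.integrable_of_hasCompactSupport hψc
  set m := ∫ x, φ x with hm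
  -- Subtracting `m * ψ` removes the mean of `φ`, so the remainder is the derivative of a test
  -- function.
  obtain ⟨Φ, hΦ, hΦc, hΦd⟩ := exists_antideriv_hasCompactSupport (χ := fun x => φ x - m * ψ x)
    (hφ.sub (contDiff_const.mul hψ)) (hφc.sub hψc.mul_left) (by
      rw [integral_sub hφi (hψi.const_mul m), integral_const_mul, hψ1, mul_one, ← hm, sub_self])
  have key := h0 Φ hΦ hΦc
  rw [hΦd] at key
  have h2 : (fun x => (φ x - m * ψ x) • h x) = fun x => φ x • h x - m • (ψ x • h x) := by
    ext x
    rw [sub_smul, mul_smul]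
  rw [h2, integral_sub (hint hφ hφc) (((hint hψ hψc).smul m : Integrable (fun x => m • (ψ x • h x)))), integral_smul, sub_eq_zero] at key
  rw [key, integral_smul_const]

/-- A primitive of a locally integrable function has that function as its weak derivative. -/
theorem integral_deriv_smul_eq_neg_of_primitive {u g : ℝ → ℂ} (hg : LocallyIntegrable g)
    (hu : ∀ x y, u y - u x = ∫ t in x..y, g t) {φ : ℝ → ℝ} (hφ : ContDiff ℝ ∞ φ)
    (hc : HasCompactSupport φ) : ∫ x, deriv φ x • u x = -∫ x, φ x • g x := by
  obtain ⟨R, hz⟩ := hc.exists_forall_abs_le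
  obtain ⟨R', hz'⟩ := hc.deriv.exists_forall_abs_le
  set S := max R R'
  have hiu : Integrable (fun x => deriv φ x • u x) :=
    (continuous_of_primitive hg hu).locallyIntegrable.integrable_smul_left_of_hasCompactSupport
      (hφ.continuous_deriv (by simp)) hc.deriv
  have hig : Integrable (fun x => φ x • g x) :=
    hg.integrable_smul_left_of_hasCompactSupport hφ.continuous hc
  rw [eq_neg_iff_add_eq_zero, ← integral_add hiu hig,
    integral_eq_intervalIntegral_of_abs (R := S) (fun x hx => by
      rw [hz x ((le_max_left _ _).trans hx), hz' x ((le_max_right _ _).trans hx)]; simp),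
    integral_deriv_smul_add_of_primitive (hφ.of_le (by simp)) hg hu,
    hz S ((le_max_left _ _).trans (le_abs_self _)),
    hz (-S) ((le_max_left _ _).trans (by rw [abs_neg]; exact le_abs_self _))]
  simp

/-- An element of `H¹(ℝ)` has a representative which is a primitive of its weak derivative. -/
theorem IsWeakDeriv.exists_primitive {f g : L2R} (h : IsWeakDeriv f g) :
    ∃ u : ℝ → ℂ, f =ᵐ[volume] u ∧ ∀ x y, u y - u x = ∫ t in x..y, g t := by
  have hg := g.locallyIntegrable
  have hG : ∀ x y, (∫ t in (0 : ℝ)..y, g t) - (∫ t in (0 : ℝ)..x, g t) = ∫ t in x..y, g t :=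
    fun x y => intervalIntegral.integral_interval_sub_left (g.intervalIntegrable _ _)
      (g.intervalIntegrable _ _)
  have hGl : LocallyIntegrable (fun x => ∫ t in (0 : ℝ)..x, g t) :=
    (continuous_of_primitive hg hG).locallyIntegrable
  -- `f` and the primitive of `g` have the same weak derivative, so they differ by a constant.
  obtain ⟨c, hc⟩ := exists_ae_eq_const_of_integral_deriv_smul_eq_zero
    (h := fun x => f x - ∫ t in (0 : ℝ)..x, g t) (f.locallyIntegrable.sub hGl) (by
      intro φ hφ hφc
      simp only [smul_sub]
      rw [integral_sub (f.integrable_smul (hφ.continuous_deriv (by simp)) hφc.deriv)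
        (hGl.integrable_smul_left_of_hasCompactSupport (hφ.continuous_deriv (by simp)) hφc.deriv),
        h φ hφ hφc, integral_deriv_smul_eq_neg_of_primitive hg hG hφ hφc, sub_self])
  refine ⟨fun x => c + ∫ t in (0 : ℝ)..x, g t, ?_, fun x y => ?_⟩
  · filter_upwards [hc] with x hx
    rw [← hx, sub_add_cancel]
  · rw [add_sub_add_left_eq_sub, hG]

/-- A compactly supported smooth function, as an element of `L²(ℝ)`, lies in `H¹(ℝ)`. -/
theorem mem_sobolevH1_of_contDiff {f : L2R} {v : ℝ → ℂ} (hf : f =ᵐ[volume] v)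
    (hv : ContDiff ℝ ∞ v) (hc : HasCompactSupport v) : f ∈ sobolevH1 := by
  have hd : Continuous (deriv v) := hv.continuous_deriv (by simp)
  have hm : MemLp (deriv v) 2 (volume : Measure ℝ) := hd.memLp_of_hasCompactSupport hc.deriv
  refine ⟨hm.toLp, fun φ hφ hφc => ?_⟩
  have h1 : ∫ x, deriv φ x • f x = ∫ x, deriv φ x • v x :=
    integral_congr_ae (by filter_upwards [hf] with x hx; rw [hx])
  have h2 : ∫ x, φ x • hm.toLp (deriv v) x = ∫ x, φ x • deriv v x := by
    refine integral_congr_ae ?_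
    filter_upwards [hm.coeFn_toLp] with x hx
    rw [hx]
  rw [h1, h2]
  refine integral_deriv_smul_eq_neg_of_primitive hd.locallyIntegrable (fun x y => ?_) hφ hφc
  exact (intervalIntegral.integral_deriv_eq_sub
    (fun t _ => (hv.differentiable (by simp)) t) (hd.intervalIntegrable _ _)).symm

/-! ### Projections onto hyperplanes of a closed subspace -/

section Hyperplane

variable {K : Type*} [NormedAddCommGroup K] [InnerProductSpace ℂ K]

/-- On `M`, pairing with `w` equals pairing with its projection `v`, so `N` is the orthogonal
complement of `v` inside `M`. The case `v = 0` is included. -/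
theorem starProjection_inf_orthogonal_span (M N : Submodule ℂ K) [M.HasOrthogonalProjection]
    [N.HasOrthogonalProjection] (w : K) (hN : N = M ⊓ (ℂ ∙ w)ᗮ) :
    N.starProjection = M.starProjection - (ℂ ∙ M.starProjection w).starProjection := by
  ext x
  set v := M.starProjection w with hv
  set Q := (ℂ ∙ v).starProjection with hQ
  have hQx : Q x ∈ ℂ ∙ v := by
    rw [hQ, Submodule.starProjection_apply]
    exact Submodule.coe_mem _
  have hvM : v ∈ M := by
    rw [hv, Submodule.starProjection_apply]
    exact Submodule.coe_mem _
  have hPx : M.starProjection x ∈ M := by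
    rw [Submodule.starProjection_apply]
    exact Submodule.coe_mem _
  have hinner : ∀ y ∈ M, inner ℂ v y = inner ℂ w y := fun y hy => by
    rw [hv, Submodule.inner_starProjection_left_eq_right,
      Submodule.starProjection_eq_self_iff.2 hy]
  have hQM : Q x ∈ M := (Submodule.span_singleton_le_iff_mem v M).2 hvM hQx
  rw [sub_apply]
  apply Submodule.eq_starProjection_of_mem_of_inner_eq_zero
  · rw [hN]
    refine ⟨M.sub_mem hPx hQM, ?_⟩
    rw [SetLike.mem_coe, Submodule.mem_orthogonal_singleton_iff_inner_right,
      ← hinner _ (M.sub_mem hPx hQM), inner_sub_right, hinner _ hPx,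
      ← Submodule.inner_starProjection_left_eq_right, ← hv,
      ← Submodule.inner_starProjection_left_eq_right,
      Submodule.starProjection_eq_self_iff.2 (Submodule.mem_span_singleton_self v), sub_self]
  · intro y hy
    rw [hN] at hy
    obtain ⟨c, hc⟩ := Submodule.mem_span_singleton.1 hQx
    have h1 : inner ℂ (x - M.starProjection x) y = 0 :=
      Submodule.starProjection_inner_eq_zero x y hy.1
    have h2 : inner ℂ (Q x) y = 0 := by
      rw [← hc, inner_smul_left, hinner y hy.1,
        Submodule.mem_orthogonal_singleton_iff_inner_right.1 hy.2, mul_zero]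
    rw [sub_sub_eq_add_sub, add_sub_right_comm, inner_add_left, h1, h2, add_zero]

/-- The projection is `‖z‖⁻² ⟨z, ·⟩ z`, norm-continuous in `z` away from `0`. -/
theorem tendsto_starProjection_span_singleton {ι : Type*} {l : Filter ι} {v : ι → K} {v₀ : K}
    (h : Tendsto v l (𝓝 v₀)) (h0 : v₀ ≠ 0) :
    Tendsto (fun i => (ℂ ∙ v i).starProjection) l (𝓝 (ℂ ∙ v₀).starProjection) := by
  have key : ∀ z : K, (ℂ ∙ z).starProjection =
      (((‖z‖ ^ 2 : ℝ) : ℂ)⁻¹) • ContinuousLinearMap.smulRightL ℂ K K (innerSL ℂ z) z := by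
    intro z
    ext x
    rw [Submodule.starProjection_singleton]
    simp [div_eq_inv_mul, mul_smul]
  simp only [key]
  refine Tendsto.smul ?_ ?_
  · refine Tendsto.inv₀ ?_ (by simpa using h0)
    exact (Complex.continuous_ofReal.tendsto _).comp ((h.norm).pow 2)
  · have hc : Continuous fun z : K => ContinuousLinearMap.smulRightL ℂ K K (innerSL ℂ z) z :=
      ((ContinuousLinearMap.smulRightL ℂ K K).continuous.comp
        (innerSL ℂ).continuous).clm_apply continuous_id
    exact (hc.tendsto v₀).comp h

end Hyperplane

/-! ### Graphs of restrictions and generalized convergence -/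

section Graph

variable {H : Type*} [NormedAddCommGroup H] [InnerProductSpace ℂ H]

theorem isClosed_of_isClosed_hilbertGraph {A : H →ₗ.[ℂ] H}
    (h : IsClosed (hilbertGraph A : Set (WithLp 2 (H × H)))) : A.IsClosed :=
  h.preimage (WithLp.prod_continuous_toLp 2 H H)

theorem mem_hilbertGraph_domRestrict {A : H →ₗ.[ℂ] H} {S : Submodule ℂ H}
    {z : WithLp 2 (H × H)} :
    z ∈ hilbertGraph (A.domRestrict S) ↔ z ∈ hilbertGraph A ∧ z.fst ∈ S := by
  simp only [hilbertGraph, Submodule.mem_comap, LinearPMap.mem_graph_iff']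
  constructor
  · rintro ⟨y, hy⟩
    have hfst : (y : H) = z.fst := congrArg Prod.fst hy
    refine ⟨⟨⟨y, y.2.2⟩, ?_⟩, hfst ▸ y.2.1⟩
    rw [← hy]
    rfl
  · rintro ⟨⟨y, hy⟩, hS⟩
    have hfst : (y : H) = z.fst := congrArg Prod.fst hy
    refine ⟨⟨y, by rw [hfst]; exact hS, y.2⟩, ?_⟩
    rw [← hy]
    rfl

/-- If the graphs are hyperplanes `M ⊓ wₙᗮ` of a fixed closed subspace and `wₙ → w`, where `w` is
not orthogonal to `M`, then the operators converge in the generalized sense. -/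
theorem convergesGeneralized_of_graph_eq_inf_orthogonal [CompleteSpace H]
    {A : ℕ → H →ₗ.[ℂ] H} {B : H →ₗ.[ℂ] H} {M : Submodule ℂ (WithLp 2 (H × H))}
    (hM : IsClosed (M : Set (WithLp 2 (H × H)))) {w : ℕ → WithLp 2 (H × H)}
    {w₀ : WithLp 2 (H × H)} (hA : ∀ n, hilbertGraph (A n) = M ⊓ (ℂ ∙ w n)ᗮ)
    (hB : hilbertGraph B = M ⊓ (ℂ ∙ w₀)ᗮ) (hw : Tendsto w atTop (𝓝 w₀))
    (hne : ∃ z ∈ M, inner ℂ w₀ z ≠ 0) : ConvergesGeneralized A B := by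
  have : CompleteSpace M := hM.completeSpace_coe
  have hcl : ∀ x, IsClosed ((M ⊓ (ℂ ∙ x)ᗮ : Submodule ℂ (WithLp 2 (H × H))) :
      Set (WithLp 2 (H × H))) := fun x => hM.inter (Submodule.isClosed_orthogonal _)
  have hAc : ∀ n, (A n).IsClosed := fun n =>
    isClosed_of_isClosed_hilbertGraph (by rw [hA n]; exact hcl _)
  have hBc : B.IsClosed := isClosed_of_isClosed_hilbertGraph (by rw [hB]; exact hcl _)
  refine ⟨hAc, hBc, ?_⟩
  have hPA : ∀ n, graphProjection (A n) (hAc n) =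
      M.starProjection - (ℂ ∙ M.starProjection (w n)).starProjection := fun n => by
    have := (isClosed_hilbertGraph (hAc n)).completeSpace_coe
    exact starProjection_inf_orthogonal_span M _ (w n) (hA n)
  have hPB : graphProjection B hBc =
      M.starProjection - (ℂ ∙ M.starProjection w₀).starProjection := by
    have := (isClosed_hilbertGraph hBc).completeSpace_coe
    exact starProjection_inf_orthogonal_span M _ w₀ hB
  have hne0 : M.starProjection w₀ ≠ 0 := by
    obtain ⟨z, hz, hwz⟩ := hne
    intro h0
    apply hwz
    rw [← Submodule.starProjection_eq_self_iff.2 hz,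
      ← Submodule.inner_starProjection_left_eq_right, h0, inner_zero_left]
  have hlim := tendsto_starProjection_span_singleton
    ((M.starProjection.continuous.tendsto w₀).comp hw) hne0
  -- The common term `P_M` cancels, leaving a difference of two projections onto lines.
  simp only [hPA, hPB, sub_sub_sub_cancel_left]
  simp_rw [norm_sub_rev ((ℂ ∙ M.starProjection w₀).starProjection)]
  exact tendsto_iff_norm_sub_tendsto_zero.1 hlim

end Graph

/-! ### The graph of the momentum operator -/

theorem mem_hilbertGraph_momentumOperator {z : WithLp 2 (L2R × L2R)} :
    z ∈ hilbertGraph momentumOperator ↔ IsWeakDeriv z.fst (-Complex.I • z.snd) := by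
  simp only [hilbertGraph, Submodule.mem_comap, LinearPMap.mem_graph_iff']
  constructor
  · rintro ⟨y, hy⟩
    have h1 : (y : L2R) = z.fst := congrArg Prod.fst hy
    have h2 : Complex.I • weakDeriv y = z.snd := congrArg Prod.snd hy
    rw [← h1, ← h2, smul_smul, neg_mul, Complex.I_mul_I, neg_neg, one_smul]
    exact isWeakDeriv_weakDeriv y
  · intro h
    refine ⟨⟨z.fst, _, h⟩, ?_⟩
    have h2 := (isWeakDeriv_weakDeriv ⟨z.fst, _, h⟩).unique h
    refine Prod.ext rfl ?_
    change Complex.I • weakDeriv ⟨z.fst, _, h⟩ = z.snd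
    rw [h2, smul_smul, mul_neg, Complex.I_mul_I, neg_neg, one_smul]

theorem continuous_integral_smul_L2R {ψ : ℝ → ℝ} (hψ : Continuous ψ) (hc : HasCompactSupport ψ) :
    Continuous fun f : L2R => ∫ x, ψ x • f x := by
  have hm : MemLp (fun x => (ψ x : ℂ)) 2 (volume : Measure ℝ) :=
    (Complex.continuous_ofReal.comp hψ).memLp_of_hasCompactSupport
      (hc.comp_left Complex.ofReal_zero)
  have h : (fun f : L2R => ∫ x, ψ x • f x) = fun f => inner ℂ (hm.toLp _) f := by
    ext f
    rw [L2.inner_def]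
    refine integral_congr_ae ?_
    filter_upwards [hm.coeFn_toLp] with x hx
    rw [hx]
    simp [mul_comm]
  rw [h]
  exact continuous_const.inner continuous_id

/-- Each test function imposes one equation between `L²`-continuous functionals of the two
components. -/
theorem isClosed_hilbertGraph_momentumOperator :
    IsClosed (hilbertGraph momentumOperator : Set (WithLp 2 (L2R × L2R))) := by
  have h : (hilbertGraph momentumOperator : Set (WithLp 2 (L2R × L2R))) =
      ⋂ (φ : ℝ → ℝ) (_ : ContDiff ℝ ∞ φ) (_ : HasCompactSupport φ),
        {z | ∫ x, deriv φ x • z.fst x = -∫ x, φ x • (-Complex.I • z.snd : L2R) x} := by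
    ext z
    simp [mem_hilbertGraph_momentumOperator, IsWeakDeriv]
  rw [h]
  have hfst : Continuous fun z : WithLp 2 (L2R × L2R) => z.fst :=
    continuous_fst.comp (WithLp.prod_continuous_ofLp 2 L2R L2R)
  have hsnd : Continuous fun z : WithLp 2 (L2R × L2R) => z.snd :=
    continuous_snd.comp (WithLp.prod_continuous_ofLp 2 L2R L2R)
  have hsnd' : Continuous fun z : WithLp 2 (L2R × L2R) => -Complex.I • z.snd :=
    (continuous_const_smul (-Complex.I)).comp hsnd
  refine isClosed_iInter fun φ => isClosed_iInter fun hφ => isClosed_iInter fun hc => ?_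
  exact isClosed_eq
    ((continuous_integral_smul_L2R (hφ.continuous_deriv (by simp)) hc.deriv).comp hfst)
    ((continuous_integral_smul_L2R hφ.continuous hc).comp hsnd').neg

/-! ### Riemann sums as inner products -/

/-- The characteristic function of `(0, 1]`, as an element of `L²(ℝ)`. -/
noncomputable def unitIndicator : L2R :=
  indicatorConstLp 2 (measurableSet_Ioc (a := (0 : ℝ)) (b := 1)) (by simp) (1 : ℂ)

theorem inner_unitIndicator (f : L2R) : inner ℂ unitIndicator f = ∫ x in (0 : ℝ)..1, f x := by
  rw [unitIndicator, L2.inner_indicatorConstLp_one, intervalIntegral.integral_of_le zero_le_one]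

/-- The function on `(0, 1]` whose value at `t` is the distance from `t` to the next multiple of
`1 / n`; it vanishes outside `(0, 1]`. -/
noncomputable def sawtooth (n : ℕ) : ℝ → ℝ :=
  (Set.Ioc 0 1).indicator fun t => (⌈n * t⌉ - n * t) / n

/-- This follows from `0 ≤ ⌈x⌉ - x < 1`; it yields both membership in `L²` and the `1/n` decay. -/
theorem abs_sawtooth_le (n : ℕ) (t : ℝ) :
    |sawtooth n t| ≤ (n : ℝ)⁻¹ * ‖(Set.Ioc (0 : ℝ) 1).indicator (fun _ => (1 : ℂ)) t‖ := by
  by_cases ht : t ∈ Set.Ioc (0 : ℝ) 1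
  · have h1 := Int.le_ceil ((n : ℝ) * t)
    have h2 := Int.ceil_lt_add_one ((n : ℝ) * t)
    rw [sawtooth, Set.indicator_of_mem ht, Set.indicator_of_mem ht, norm_one, mul_one, abs_div,
      abs_of_nonneg (by linarith), Nat.abs_cast, div_eq_mul_inv]
    exact mul_le_of_le_one_left (by positivity) (by linarith)
  · simp [sawtooth, Set.indicator_of_notMem ht]

theorem measurable_sawtooth (n : ℕ) : Measurable (sawtooth n) := by
  refine Measurable.indicator ?_ measurableSet_Ioc
  have h : Measurable fun t : ℝ => ((⌈n * t⌉ : ℤ) : ℝ) :=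
    measurable_from_top.comp (Int.measurable_ceil.comp (measurable_const_mul _))
  exact (h.sub (measurable_const_mul _)).div_const _

theorem memLp_sawtooth (n : ℕ) : MemLp (fun t => (sawtooth n t : ℂ)) 2 (volume : Measure ℝ) := by
  have h := memLp_indicator_const (μ := (volume : Measure ℝ)) 2
    (measurableSet_Ioc (a := (0 : ℝ)) (b := 1)) (1 : ℂ) (Or.inr (by simp))
  refine h.of_le_mul (c := (n : ℝ)⁻¹)
    (Complex.measurable_ofReal.comp (measurable_sawtooth n)).aestronglyMeasurable
    (Eventually.of_forall fun t => ?_)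
  rw [Complex.norm_real]
  exact abs_sawtooth_le n t

/-- The sawtooth function as an element of `L²(ℝ)`. -/
noncomputable def sawtoothL2 (n : ℕ) : L2R := (memLp_sawtooth n).toLp _

theorem norm_sawtoothL2_le (n : ℕ) : ‖sawtoothL2 n‖ ≤ (n : ℝ)⁻¹ * ‖unitIndicator‖ := by
  refine Lp.norm_le_mul_norm_of_ae_le_mul ?_
  filter_upwards [(memLp_sawtooth n).coeFn_toLp,
    indicatorConstLp_coeFn (p := 2) (hs := measurableSet_Ioc (a := (0 : ℝ)) (b := 1))
      (hμs := by simp) (c := (1 : ℂ))] with t h1 h2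
  rw [sawtoothL2, unitIndicator, h1, h2, Complex.norm_real]
  exact abs_sawtooth_le n t

theorem tendsto_sawtoothL2 : Tendsto (fun n : ℕ => sawtoothL2 (n + 1)) atTop (𝓝 0) := by
  refine squeeze_zero_norm (fun n => norm_sawtoothL2_le (n + 1)) ?_
  have h := (tendsto_inv_atTop_nhds_zero_nat (𝕜 := ℝ)).comp (tendsto_add_atTop_nat 1)
  simpa using h.mul_const ‖unitIndicator‖

theorem inner_sawtoothL2 (n : ℕ) (g : L2R) :
    inner ℂ (sawtoothL2 n) g = ∫ t in (0 : ℝ)..1, ((⌈n * t⌉ - n * t) / n : ℝ) • g t := by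
  rw [L2.inner_def, intervalIntegral.integral_of_le zero_le_one,
    ← integral_indicator measurableSet_Ioc]
  refine integral_congr_ae ?_
  filter_upwards [(memLp_sawtooth n).coeFn_toLp] with t ht
  rw [sawtoothL2, ht, sawtooth]
  by_cases h : t ∈ Set.Ioc (0 : ℝ) 1
  · rw [Set.indicator_of_mem h, Set.indicator_of_mem h, RCLike.inner_apply, Complex.conj_ofReal,
      Complex.real_smul, mul_comm]
  · rw [Set.indicator_of_notMem h, Set.indicator_of_notMem h]
    simp

/-- The weight `b - t` vanishes at `b`, so integration by parts leaves only the left endpoint value,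
as a left Riemann sum requires. -/
theorem integral_sub_smul_of_primitive {u g : ℝ → ℂ} (hg : LocallyIntegrable g)
    (hu : ∀ x y, u y - u x = ∫ t in x..y, g t) (a b : ℝ) :
    ∫ t in a..b, (b - t) • g t = (∫ t in a..b, u t) - (b - a) • u a := by
  have huc := continuous_of_primitive hg hu
  have hd : ∀ x, deriv (fun t : ℝ => b - t) x = -1 := fun x => by
    simp
  have h := integral_deriv_smul_add_of_primitive (φ := fun t => b - t)
    (contDiff_const.sub contDiff_id) hg hu a b
  simp only [hd] at h
  have h1 : IntervalIntegrable (fun t => (-1 : ℝ) • u t) volume a b :=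
    (huc.const_smul (-1 : ℝ)).intervalIntegrable _ _
  have h2 : IntervalIntegrable (fun t => (b - t) • g t) volume a b :=
    (hg.intervalIntegrable_real a b).continuousOn_smul
      (continuous_const.sub continuous_id).continuousOn
  rw [intervalIntegral.integral_add h1 h2] at h
  simp only [neg_smul, one_smul, sub_self, zero_smul, zero_sub,
    intervalIntegral.integral_neg] at h
  linear_combination h

theorem ceil_mul_eq_of_mem_Ioc {n j : ℕ} (hn : 0 < n) {t : ℝ}
    (ht : t ∈ Set.Ioc ((j : ℝ) / n) (((j + 1 : ℕ) : ℝ) / n)) :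
    ((⌈n * t⌉ : ℤ) : ℝ) = j + 1 := by
  have hn' : (0 : ℝ) < n := Nat.cast_pos.2 hn
  have h : ⌈(n : ℝ) * t⌉ = (j : ℤ) + 1 := by
    rw [Int.ceil_eq_iff]
    have h1 := (div_lt_iff₀' hn').1 ht.1
    have h2 := (le_div_iff₀' hn').1 ht.2
    push_cast at h2 ⊢
    constructor <;> linarith
  rw [h]
  push_cast
  rfl

/-- On the `j`-th cell the weight is `(j+1)/n - t`; summing the one-cell formula gives the
quadrature error. -/
theorem integral_sawtooth_smul_of_primitive {u g : ℝ → ℂ} (hg : LocallyIntegrable g)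
    (hu : ∀ x y, u y - u x = ∫ t in x..y, g t) {n : ℕ} (hn : 0 < n) :
    ∫ t in (0 : ℝ)..1, ((⌈n * t⌉ - n * t) / n : ℝ) • g t =
      (∫ t in (0 : ℝ)..1, u t) - (n : ℂ)⁻¹ * ∑ j ∈ Finset.range n, u ((j : ℝ) / n) := by
  have hn' : (0 : ℝ) < n := Nat.cast_pos.2 hn
  have huc := continuous_of_primitive hg hu
  set a : ℕ → ℝ := fun j => (j : ℝ) / n with ha
  have hmono : ∀ j, a j ≤ a (j + 1) := fun j => by
    simp only [ha]
    gcongr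
    simp
  have hcongr : ∀ j : ℕ, Set.EqOn (fun t : ℝ => ((⌈n * t⌉ - n * t) / n : ℝ) • g t)
      (fun t => (a (j + 1) - t) • g t) (Set.uIoc (a j) (a (j + 1))) := fun j t ht => by
    rw [Set.uIoc_of_le (hmono j)] at ht
    simp only [ceil_mul_eq_of_mem_Ioc hn ht, ha]
    congr 1
    push_cast
    field_simp
  have hint : ∀ j : ℕ, IntervalIntegrable (fun t => (a (j + 1) - t) • g t) volume (a j) (a (j + 1)) :=
    fun j => (hg.intervalIntegrable_real _ _).continuousOn_smul
      (continuous_const.sub continuous_id).continuousOn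
  have hint' : ∀ j : ℕ, IntervalIntegrable (fun t : ℝ => ((⌈n * t⌉ - n * t) / n : ℝ) • g t) volume
      (a j) (a (j + 1)) := fun j => (hint j).congr (hcongr j).symm
  have ha0 : a 0 = 0 := by simp [ha]
  have ha1 : a n = 1 := by simp [ha, hn'.ne']
  have e1 := intervalIntegral.sum_integral_adjacent_intervals (n := n) fun k _ => hint' k
  have e2 := intervalIntegral.sum_integral_adjacent_intervals (n := n) (a := a) (f := u)
    (μ := volume) fun k _ => huc.intervalIntegrable _ _
  rw [ha0, ha1] at e1 e2
  rw [← e1, ← e2, Finset.mul_sum, ← Finset.sum_sub_distrib]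
  refine Finset.sum_congr rfl fun j _ => ?_
  rw [intervalIntegral.integral_congr_ae (Eventually.of_forall fun t ht => hcongr j ht),
    integral_sub_smul_of_primitive hg hu]
  congr 1
  have : a (j + 1) - a j = (n : ℝ)⁻¹ := by
    simp only [ha]
    push_cast
    field_simp
    ring
  rw [this, Complex.real_smul, Complex.ofReal_inv, Complex.ofReal_natCast]

/-- On the graph of the momentum operator, taking the inner product with this vector is the same
as taking the Riemann sum `n⁻¹ ∑_{j < n} f (j / n)` of the first component. -/
noncomputable def riemannSumVector (n : ℕ) : WithLp 2 (L2R × L2R) :=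
  WithLp.toLp 2 (unitIndicator, -Complex.I • sawtoothL2 n)

theorem inner_riemannSumVector {z : WithLp 2 (L2R × L2R)} {u : ℝ → ℂ} (hzu : z.fst =ᵐ[volume] u)
    (hu : ∀ x y, u y - u x = ∫ t in x..y, (-Complex.I • z.snd : L2R) t) {n : ℕ} (hn : 0 < n) :
    inner ℂ (riemannSumVector n) z = (n : ℂ)⁻¹ * ∑ j ∈ Finset.range n, u ((j : ℝ) / n) := by
  have h1 : inner ℂ unitIndicator z.fst = ∫ t in (0 : ℝ)..1, u t := by
    rw [inner_unitIndicator]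
    exact intervalIntegral.integral_congr_ae (hzu.mono fun t ht _ => ht)
  have h2 := inner_sawtoothL2 n (-Complex.I • z.snd)
  rw [integral_sawtooth_smul_of_primitive (L2R.locallyIntegrable _) hu hn, inner_smul_right] at h2
  rw [WithLp.prod_inner_apply]
  change inner ℂ unitIndicator z.fst + inner ℂ (-Complex.I • sawtoothL2 n) z.snd = _
  -- The inner product is conjugate-linear on the left, so the second component contributes minus
  -- the quadrature error.
  rw [inner_smul_left, h1, map_neg, Complex.conj_I]
  linear_combination -h2

theorem hilbertGraph_riemannSumMomentum {n : ℕ} (hn : 0 < n) :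
    hilbertGraph (riemannSumMomentum n) =
      hilbertGraph momentumOperator ⊓ (ℂ ∙ riemannSumVector n)ᗮ := by
  ext z
  rw [riemannSumMomentum, mem_hilbertGraph_domRestrict, Submodule.mem_inf]
  refine and_congr_right fun hz => ?_
  obtain ⟨u, hzu, hu⟩ := (mem_hilbertGraph_momentumOperator.1 hz).exists_primitive
  have huc := continuous_of_primitive (L2R.locallyIntegrable _) hu
  have hn' : (n : ℂ) ≠ 0 := Nat.cast_ne_zero.2 hn.ne'
  rw [Submodule.mem_orthogonal_singleton_iff_inner_right, inner_riemannSumVector hzu hu hn,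
    mul_eq_zero, or_iff_right (inv_ne_zero hn')]
  constructor
  · rintro ⟨v, hv, hzv, hv0⟩
    -- Continuous representatives are unique, so `v` is the primitive `u`.
    rwa [(huc.ae_eq_iff_eq volume hv).1 (hzu.symm.trans hzv)]
  · exact fun h => ⟨u, huc, hzu, h⟩

theorem hilbertGraph_integralMomentum :
    hilbertGraph integralMomentum = hilbertGraph momentumOperator ⊓
      (ℂ ∙ (WithLp.toLp 2 (unitIndicator, 0) : WithLp 2 (L2R × L2R)))ᗮ := by
  ext z
  rw [integralMomentum, mem_hilbertGraph_domRestrict, Submodule.mem_inf,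
    Submodule.mem_orthogonal_singleton_iff_inner_right, WithLp.prod_inner_apply]
  change _ ↔ _ ∧ inner ℂ unitIndicator z.fst + inner ℂ (0 : L2R) z.snd = 0
  rw [inner_zero_left, add_zero, inner_unitIndicator]
  rfl

theorem tendsto_riemannSumVector :
    Tendsto (fun n : ℕ => riemannSumVector (n + 1)) atTop
      (𝓝 (WithLp.toLp 2 (unitIndicator, 0))) := by
  refine ((WithLp.prod_continuous_toLp 2 L2R L2R).tendsto _).comp
    (tendsto_const_nhds.prodMk_nhds ?_)
  simpa using tendsto_sawtoothL2.const_smul (-Complex.I)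

/-! ### Density of the domains -/

theorem exists_mem_sobolevH1_integral_ne_zero :
    ∃ f ∈ sobolevH1, ∫ x in (0 : ℝ)..1, f x ≠ 0 := by
  -- The support lies in `[0, 1]`, so the interval captures the whole mass `1`.
  let b : ContDiffBump (1 / 2 : ℝ) := ⟨1 / 4, 1 / 2, by norm_num, by norm_num⟩
  have hb : ContDiff ℝ ∞ fun x => (b.normed volume x : ℂ) :=
    Complex.ofRealCLM.contDiff.comp b.contDiff_normed
  have hc : HasCompactSupport fun x => (b.normed volume x : ℂ) :=
    b.hasCompactSupport_normed.comp_left Complex.ofReal_zero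
  have hm : MemLp (fun x => (b.normed volume x : ℂ)) 2 (volume : Measure ℝ) :=
    hb.continuous.memLp_of_hasCompactSupport hc
  refine ⟨hm.toLp _, mem_sobolevH1_of_contDiff hm.coeFn_toLp hb hc, ?_⟩
  have h1 : ∫ x in (0 : ℝ)..1, hm.toLp _ x = ∫ x in (0 : ℝ)..1, (b.normed volume x : ℂ) :=
    intervalIntegral.integral_congr_ae (hm.coeFn_toLp.mono fun t ht _ => ht)
  rw [h1, intervalIntegral.integral_ofReal,
    intervalIntegral.integral_eq_integral_of_support_subset, b.integral_normed]
  · simp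
  · rw [b.support_normed_eq, Real.ball_eq_Ioo]
    refine Set.Subset.trans (fun x hx => ?_) Set.Ioo_subset_Ioc_self
    have h2 : b.rOut = 1 / 2 := rfl
    rw [h2] at hx
    exact ⟨by linarith [hx.1], by linarith [hx.2]⟩

theorem not_dense_domain_integralMomentum : ¬ Dense (integralMomentum.domain : Set L2R) := by
  intro hd
  obtain ⟨f, -, hf⟩ := exists_mem_sobolevH1_integral_ne_zero
  have hcl : IsClosed {g : L2R | inner ℂ unitIndicator g = 0} :=
    isClosed_eq (continuous_const.inner continuous_id) continuous_const
  have hsub : (integralMomentum.domain : Set L2R) ⊆ {g : L2R | inner ℂ unitIndicator g = 0} :=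
    fun g hg => (inner_unitIndicator g).trans hg.1
  have := closure_minimal hsub hcl (hd f)
  exact hf ((inner_unitIndicator f).symm.trans this)

/-- Smooth functions of arbitrarily small `L²`-norm with value `1` at `0` and supported in a given
neighbourhood of `0`. -/
theorem exists_smooth_spikes {r : ℝ} (hr : 0 < r) :
    ∃ (e : ℕ → L2R) (v : ℕ → ℝ → ℂ), Tendsto e atTop (𝓝 0) ∧ ∀ k, e k =ᵐ[volume] v k ∧
      ContDiff ℝ ∞ (v k) ∧ HasCompactSupport (v k) ∧ v k 0 = 1 ∧ ∀ x, r ≤ |x| → v k x = 0 := by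
  have hrk : ∀ k : ℕ, 0 < r / (k + 1) := fun k => by positivity
  let b : ℕ → ContDiffBump (0 : ℝ) := fun k =>
    ⟨r / (k + 1) / 2, r / (k + 1), half_pos (hrk k), half_lt_self (hrk k)⟩
  have hb : ∀ k, ContDiff ℝ ∞ fun x => (b k x : ℂ) := fun k =>
    Complex.ofRealCLM.contDiff.comp (b k).contDiff
  have hc : ∀ k, HasCompactSupport fun x => (b k x : ℂ) := fun k =>
    (b k).hasCompactSupport.comp_left Complex.ofReal_zero
  have hz : ∀ (k : ℕ) (x : ℝ), r / (k + 1) ≤ |x| → b k x = 0 := fun k x hx =>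
    (b k).zero_of_le_dist (by rwa [Real.dist_eq, sub_zero])
  have hm : ∀ k, MemLp (fun x => (b k x : ℂ)) 2 (volume : Measure ℝ) := fun k =>
    (hb k).continuous.memLp_of_hasCompactSupport (hc k)
  have hlim : Tendsto (fun k : ℕ => r / ((k : ℝ) + 1)) atTop (𝓝 0) := by
    have := (tendsto_const_div_atTop_nhds_zero_nat r).comp (tendsto_add_atTop_nat 1)
    simpa [Function.comp_def] using this
  refine ⟨fun k => (hm k).toLp _, fun k x => (b k x : ℂ), ?_, fun k =>
    ⟨(hm k).coeFn_toLp, hb k, hc k, ?_, fun x hx => ?_⟩⟩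
  · let s : ℕ → Set ℝ := fun k => Set.Ioc (-(r / (k + 1))) (r / (k + 1))
    have hs : ∀ k, volume (s k) ≠ ⊤ := fun k => by simp [s]
    refine squeeze_zero_norm (a := fun k : ℕ => (2 * (r / ((k : ℝ) + 1))) ^ (1 / 2 : ℝ))
      (fun k => ?_) ?_
    · have h1 : ‖(hm k).toLp _‖ ≤
          ‖indicatorConstLp 2 (measurableSet_Ioc : MeasurableSet (s k)) (hs k) (1 : ℂ)‖ := by
        refine Lp.norm_le_norm_of_ae_le ?_
        filter_upwards [(hm k).coeFn_toLp, indicatorConstLp_coeFn (p := 2)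
          (hs := (measurableSet_Ioc : MeasurableSet (s k))) (hμs := hs k) (c := (1 : ℂ))]
          with x h1 h2
        rw [h1, h2, Complex.norm_real, Real.norm_of_nonneg (b k).nonneg]
        by_cases hx : x ∈ s k
        · rw [Set.indicator_of_mem hx, norm_one]
          exact (b k).le_one
        · rw [Set.indicator_of_notMem hx, norm_zero, hz k x]
          by_contra! hlt
          exact hx ⟨(abs_lt.1 hlt).1, (abs_lt.1 hlt).2.le⟩
      refine h1.trans (norm_indicatorConstLp_le.trans (le_of_eq ?_))
      rw [norm_one, one_mul, Real.volume_real_Ioc_of_le (by linarith [hrk k])]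
      norm_num
      ring_nf
    · have := (hlim.const_mul 2).rpow_const (p := (1 / 2 : ℝ)) (Or.inr (by norm_num))
      simpa [Real.zero_rpow] using this
  · have : b k 0 = 1 := (b k).one_of_mem_closedBall (Metric.mem_closedBall_self (b k).rIn_pos.le)
    simp [this]
  · change (b k x : ℂ) = 0
    rw [hz k x ((div_le_self hr.le (by simp)).trans hx), Complex.ofReal_zero]

/-- Starting from a smooth compactly supported `f`, subtracting its nodal sum times a thin spike at
the node `0` restores the constraint at vanishing `L²` cost. -/
theorem dense_domain_riemannSumMomentum {n : ℕ} (hn : 0 < n) :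
    Dense ((riemannSumMomentum n).domain : Set L2R) := by
  have hn' : (0 : ℝ) < n := Nat.cast_pos.2 hn
  -- Radius `1/n` makes the spikes vanish at every node other than `0`.
  obtain ⟨e, v, he, hev⟩ := exists_smooth_spikes (r := (n : ℝ)⁻¹) (by positivity)
  refine Dense.of_closure ((Lp.dense_hasCompactSupport_contDiff (p := 2) (F := ℂ)
    (μ := (volume : Measure ℝ)) (by simp)).mono ?_)
  rintro f ⟨w, hfw, hwc, hw⟩
  set s : ℂ := ∑ j ∈ Finset.range n, w ((j : ℝ) / n) with hs
  have hlim : Tendsto (fun k => f - s • e k) atTop (𝓝 f) := by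
    simpa using (tendsto_const_nhds (x := f)).sub (he.const_smul s)
  refine mem_closure_of_tendsto hlim (Eventually.of_forall fun k => ?_)
  obtain ⟨hek, hvk, hvkc, hv0, hvz⟩ := hev k
  refine ⟨⟨fun x => w x - s * v k x, hw.continuous.sub (continuous_const.mul hvk.continuous),
    ?_, ?_⟩, sobolevH1.sub_mem (mem_sobolevH1_of_contDiff hfw hw hwc)
      (sobolevH1.smul_mem s (mem_sobolevH1_of_contDiff hek hvk hvkc))⟩
  · filter_upwards [hfw, hek, Lp.coeFn_sub f (s • e k), Lp.coeFn_smul s (e k)] with x h1 h2 h3 h4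
    rw [h3, Pi.sub_apply, h4, Pi.smul_apply, h1, h2, smul_eq_mul]
  · have hsum : ∑ j ∈ Finset.range n, v k ((j : ℝ) / n) = 1 := by
      rw [Finset.sum_eq_single_of_mem 0 (Finset.mem_range.2 hn)]
      · simpa using hv0
      · intro j _ hj
        refine hvz _ ?_
        rw [abs_of_nonneg (by positivity), inv_eq_one_div]
        gcongr
        exact_mod_cast Nat.one_le_iff_ne_zero.2 hj
    rw [Finset.sum_sub_distrib, ← Finset.mul_sum, hsum, mul_one, hs, sub_self]

/-- The shift `n + 1` starts the sequence at `C_1`; closedness of all the operators is part of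
`ConvergesGeneralized`. -/
theorem mainTheorem8 :
    (∀ n : ℕ, 1 ≤ n → Dense ((riemannSumMomentum n).domain : Set L2R)) ∧
    ¬ Dense (integralMomentum.domain : Set L2R) ∧
    ConvergesGeneralized (fun n : ℕ => riemannSumMomentum (n + 1)) integralMomentum := by
  refine ⟨fun n hn => dense_domain_riemannSumMomentum hn, not_dense_domain_integralMomentum,
    convergesGeneralized_of_graph_eq_inf_orthogonal isClosed_hilbertGraph_momentumOperator
      (fun n => hilbertGraph_riemannSumMomentum n.succ_pos) hilbertGraph_integralMomentum
      tendsto_riemannSumVector ?_⟩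
  obtain ⟨f, ⟨g, hg⟩, hne⟩ := exists_mem_sobolevH1_integral_ne_zero
  refine ⟨WithLp.toLp 2 (f, Complex.I • g), mem_hilbertGraph_momentumOperator.2 ?_, ?_⟩
  · change IsWeakDeriv f (-Complex.I • Complex.I • g)
    rwa [smul_smul, neg_mul, Complex.I_mul_I, neg_neg, one_smul]
  · rw [WithLp.prod_inner_apply]
    change inner ℂ unitIndicator f + inner ℂ (0 : L2R) (Complex.I • g) ≠ 0
    rwa [inner_zero_left, add_zero, inner_unitIndicator]
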